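/- Consider $n$ qubits on a line, with Hilbert space $\mathcal H=(\mathbb C^2)^{\otimes n}$. Let $\mathrm{Cl}_n$ be the $n$-qubit Clifford group, i.e. the normalizer in the unitary group $\mathbb U(\mathcal H)$ of the Pauli group $\{\pm1,\pm i\}\cdot\{I,X,Y,Z\}^{\otimes n}$. A \emph{2-local Clifford gate} is an element of $\mathrm{Cl}_n$ that acts non-trivially only on a pair of neighbouring qubits (or on a single qubit); a \emph{depth-$L$ circuit} is a product of $L$ layers, each layer being a product of 2-local Clifford gates on pairwise disjoint sets of qubits (a layer may be empty). For a probability measure $\mathcal E$ on $\mathbb U(\mathcal H)$ let $$\phi^{(8)}_{\mathcal E}(A)=\mathbb E_{U\sim\mathcal E}\big[U^{\otimes 8}A\,(U^\dagger)^{\otimes 8}\big],\qquad A\in\mathcal L(\mathcal H^{\otimes 8}),$$ and let $\phi^{(8)}_{\mathrm{Cl}_n}$ be the same map for the Haar probability measure on the compact group $\mathrm{Cl}_n$. Let $\|\Phi\|_\diamond=\sup_{\rho}\|(\Phi\otimes\mathcal I_{\rm anc})(\rho)\|_1$, where $\rho$ runs over all states on $\mathcal H^{\otimes 8}\otimes\mathcal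 H_{\rm anc}$ with $\mathcal H_{\rm anc}$ of arbitrary finite dimension. $\mathcal E$ is an (additive) $\varepsilon$-approximate Clifford 8-design if $\|\phi^{(8)}_{\mathcal E}-\phi^{(8)}_{\mathrm{Cl}_n}\|_\diamond\le\varepsilon$. Any ensemble built from 2-local Clifford gates needs depth $L\ge n-1$ to form an approximate Clifford 8-design. Precisely: let $n,L\ge 0$ be integers, let $0\le\varepsilon\le 3/2$, and let $\mathcal E$ be a probability measure on $\mathbb U(\mathcal H)$ such that $\mathcal E$-almost every $U$ is a depth-$L$ circuit of 2-local Clifford gates. If $\mathcal E$ is an additive $\varepsilon$-approximate Clifford 8-design, then $L\ge n-1$. -/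

import Mathlib

open MeasureTheory
open scoped NNReal ENNReal ComplexOrder

noncomputable section

namespace CliffordDesign

/-! ### Trace norm and diamond norm -/

section Norms

variable {X : Type*} [Fintype X] [DecidableEq X]

/-- The trace norm `‖A‖₁ = Tr √(A† A)`: the sum of the singular values of `A`. -/
def traceNorm (A : Matrix X X ℂ) : ℝ :=
  ∑ i, √((Matrix.isHermitian_conjTranspose_mul_self A).eigenvalues i)

/-- Quantum states (density matrices) on `ℂ^X`. -/
def IsState (ρ : Matrix X X ℂ) : Prop := ρ.PosSemidef ∧ ρ.trace = 1

/-- The map `Φ ⊗ id` on operators on `ℂ^X ⊗ ℂ^Y`. -/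
def tensorId {Y : Type*} (Φ : Matrix X X ℂ →ₗ[ℂ] Matrix X X ℂ)
    (ρ : Matrix (X × Y) (X × Y) ℂ) : Matrix (X × Y) (X × Y) ℂ :=
  Matrix.of fun p q => Φ (Matrix.of fun x x' => ρ (x, p.2) (x', q.2)) p.1 q.1

/-- The diamond norm `sup_ρ ‖(Φ ⊗ id) ρ‖₁`, where `ρ` runs over the states on the system together
with an ancilla of arbitrary finite dimension `m`. -/
def diamondNorm (Φ : Matrix X X ℂ →ₗ[ℂ] Matrix X X ℂ) : ℝ≥0∞ :=
  ⨆ (m : ℕ) (ρ : Matrix (X × Fin m) (X × Fin m) ℂ) (_ : IsState ρ),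
    ENNReal.ofReal (traceNorm (tensorId Φ ρ))

end Norms

/-! ### Ensembles of unitaries, moment channels and designs -/

section Ensembles

variable {X : Type*} [Fintype X] [DecidableEq X]

/-- An ensemble of unitaries is a Borel probability measure on the unitary group. -/
instance : MeasurableSpace (Matrix.unitaryGroup X ℂ) := borel _

instance : BorelSpace (Matrix.unitaryGroup X ℂ) := ⟨rfl⟩

instance : IsTopologicalGroup (Matrix.unitaryGroup X ℂ) :=
  inferInstanceAs (IsTopologicalGroup (unitary (Matrix X X ℂ)))

instance : CompactSpace (Matrix.unitaryGroup X ℂ) := by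
  refine isCompact_iff_compactSpace.mp ?_
  have hK : IsCompact (Set.pi Set.univ fun _ : X => Set.pi Set.univ fun _ : X =>
      Metric.closedBall (0 : ℂ) 1) :=
    isCompact_univ_pi fun _ => isCompact_univ_pi fun _ => isCompact_closedBall _ _
  refine hK.of_isClosed_subset ?_ ?_
  · have : (Matrix.unitaryGroup X ℂ : Set (Matrix X X ℂ))
        = {U | star U * U = 1} ∩ {U | U * star U = 1} := by
      ext U; exact Unitary.mem_iff
    change IsClosed (Matrix.unitaryGroup X ℂ : Set (Matrix X X ℂ))
    rw [this]
    exact (isClosed_eq (by fun_prop) continuous_const).inter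
      (isClosed_eq (by fun_prop) continuous_const)
  · intro U hU i _ j _
    simpa using entry_norm_bound_of_unitary hU i j

/-- The tensor power `U^{⊗k}`, acting on `k` copies of `ℂ^X`. -/
def tensorPow (k : ℕ) (U : Matrix X X ℂ) : Matrix (Fin k → X) (Fin k → X) ℂ :=
  Matrix.of fun x y => ∏ j, U (x j) (y j)

/-- The operator `U^{⊗k} A (U†)^{⊗k}`. -/
def conjPow (k : ℕ) (U : Matrix X X ℂ) (A : Matrix (Fin k → X) (Fin k → X) ℂ) :
    Matrix (Fin k → X) (Fin k → X) ℂ :=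
  tensorPow k U * A * tensorPow k U.conjTranspose

theorem integrable_conjPow (k : ℕ) (ℰ : Measure (Matrix.unitaryGroup X ℂ)) [IsFiniteMeasure ℰ]
    (A : Matrix (Fin k → X) (Fin k → X) ℂ) (x y : Fin k → X) :
    Integrable (fun U : Matrix.unitaryGroup X ℂ => conjPow k (U : Matrix X X ℂ) A x y) ℰ := by
  have hc : Continuous
      (fun U : Matrix.unitaryGroup X ℂ => conjPow k (U : Matrix X X ℂ) A x y) := by
    have hU : ∀ i j, Continuous fun U : Matrix.unitaryGroup X ℂ => (U : Matrix X X ℂ) i j :=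
      fun i j => (continuous_subtype_val.matrix_elem i j)
    simp only [conjPow, Matrix.mul_apply, tensorPow, Matrix.conjTranspose_apply, Matrix.of_apply]
    refine continuous_finsetSum _ fun a _ => Continuous.mul ?_ ?_
    · exact continuous_finsetSum _ fun b _ =>
        (continuous_finsetProd _ fun j _ => hU _ _).mul continuous_const
    · exact continuous_finsetProd _ fun j _ => continuous_star.comp (hU _ _)
  exact hc.integrable_of_hasCompactSupport (HasCompactSupport.of_compactSpace _)

/-- The `k`-th moment channel `A ↦ 𝔼_{U ∼ ℰ} [U^{⊗k} A (U†)^{⊗k}]` of an ensemble, the expectation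
being taken entry by entry. -/
def momentChannel (k : ℕ) (ℰ : Measure (Matrix.unitaryGroup X ℂ)) [IsFiniteMeasure ℰ] :
    Matrix (Fin k → X) (Fin k → X) ℂ →ₗ[ℂ] Matrix (Fin k → X) (Fin k → X) ℂ where
  toFun A := Matrix.of fun x y => ∫ U : Matrix.unitaryGroup X ℂ, conjPow k (U : Matrix X X ℂ) A x y ∂ℰ
  map_add' A B := by
    ext x y
    simp only [Matrix.add_apply, Matrix.of_apply]
    rw [← integral_add (integrable_conjPow k ℰ A x y) (integrable_conjPow k ℰ B x y)]
    simp [conjPow, Matrix.mul_add, Matrix.add_mul]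
  map_smul' c A := by
    ext x y
    simp only [Matrix.smul_apply, Matrix.of_apply, RingHom.id_apply]
    rw [← integral_smul]
    simp [conjPow]

/-- The Haar probability measure of a compact group `G` of unitaries, as an ensemble. -/
def haarEnsemble (G : Subgroup (Matrix.unitaryGroup X ℂ)) [CompactSpace G] :
    Measure (Matrix.unitaryGroup X ℂ) :=
  (Measure.haarMeasure (⊤ : TopologicalSpace.PositiveCompacts G)).map Subtype.val

instance (G : Subgroup (Matrix.unitaryGroup X ℂ)) [CompactSpace G] :
    IsProbabilityMeasure (haarEnsemble G) := by
  have : IsProbabilityMeasure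
      (Measure.haarMeasure (⊤ : TopologicalSpace.PositiveCompacts G)) :=
    ⟨Measure.haarMeasure_self (K₀ := (⊤ : TopologicalSpace.PositiveCompacts G))⟩
  exact Measure.isProbabilityMeasure_map measurable_subtype_coe.aemeasurable

/-- `ℰ` is an additive `ε`-approximate `k`-design over `G`: its `k`-th moment channel is within
`ε` of that of the Haar measure on `G`, in diamond norm. -/
def IsApproxDesign (G : Subgroup (Matrix.unitaryGroup X ℂ)) [CompactSpace G] (k : ℕ) (ε : ℝ≥0)
    (ℰ : Measure (Matrix.unitaryGroup X ℂ)) [IsProbabilityMeasure ℰ] : Prop :=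
  diamondNorm (momentChannel k ℰ - momentChannel k (haarEnsemble G)) ≤ (ε : ℝ≥0∞)

end Ensembles

/-! ### The Pauli group and the Clifford group on `n` qubits

The computational basis of `(ℂ²)^{⊗n}` is indexed by the bit strings `Fin n → Fin 2`. -/

/-- The unitary group of `n` qubits. -/
abbrev QubitUnitary (n : ℕ) := Matrix.unitaryGroup (Fin n → Fin 2) ℂ

/-- The Pauli matrices `I, X, Y, Z`. -/
def pauli : Fin 4 → Matrix (Fin 2) (Fin 2) ℂ :=
  ![1, !![0, 1; 1, 0], !![0, -Complex.I; Complex.I, 0], !![1, 0; 0, -1]]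

/-- The Pauli string `P_{p 0} ⊗ ⋯ ⊗ P_{p (n-1)}`. -/
def pauliString {n : ℕ} (p : Fin n → Fin 4) : Matrix (Fin n → Fin 2) (Fin n → Fin 2) ℂ :=
  Matrix.of fun x y => ∏ i, pauli (p i) (x i) (y i)

theorem pauli_mul (a b : Fin 4) :
    ∃ (e : ℕ) (c : Fin 4), pauli a * pauli b = Complex.I ^ e • pauli c := by
  fin_cases a <;> fin_cases b
  · exact ⟨0, 0, by simp [pauli]⟩
  · exact ⟨0, 1, by simp [pauli]⟩
  · exact ⟨0, 2, by simp [pauli]⟩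
  · exact ⟨0, 3, by simp [pauli]⟩
  · exact ⟨0, 1, by simp [pauli]⟩
  · exact ⟨0, 0, by simp [pauli, Matrix.one_fin_two]⟩
  · exact ⟨1, 3, by simp [pauli]⟩
  · exact ⟨3, 2, by simp [pauli, pow_succ]⟩
  · exact ⟨0, 2, by simp [pauli]⟩
  · exact ⟨3, 3, by simp [pauli, pow_succ]⟩
  · exact ⟨0, 0, by simp [pauli, Matrix.one_fin_two]⟩
  · exact ⟨1, 1, by simp [pauli]⟩
  · exact ⟨0, 3, by simp [pauli]⟩
  · exact ⟨1, 2, by simp [pauli]⟩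
  · exact ⟨3, 1, by simp [pauli, pow_succ]⟩
  · exact ⟨0, 0, by simp [pauli, Matrix.one_fin_two]⟩

theorem pauli_conjTranspose (a : Fin 4) : (pauli a).conjTranspose = pauli a := by
  fin_cases a <;> ext i j <;> fin_cases i <;> fin_cases j <;> simp [pauli]

theorem pauliString_zero (n : ℕ) : pauliString (0 : Fin n → Fin 4) = 1 := by
  ext x y
  simp only [pauliString, Matrix.of_apply, pauli, Pi.zero_apply, Matrix.cons_val_zero, Matrix.one_apply,
    funext_iff]
  rw [Finset.prod_ite_zero]
  simp

theorem pauliString_mul {n : ℕ} (p q : Fin n → Fin 4) :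
    ∃ (e : ℕ) (r : Fin n → Fin 4), pauliString p * pauliString q = Complex.I ^ e • pauliString r := by
  choose e c h using pauli_mul
  refine ⟨∑ i, e (p i) (q i), fun i => c (p i) (q i), ?_⟩
  ext x y
  simp only [Matrix.mul_apply, Matrix.smul_apply, pauliString, Matrix.of_apply, smul_eq_mul]
  rw [← Finset.prod_pow_eq_pow_sum, ← Finset.prod_mul_distrib]
  simp_rw [← Finset.prod_mul_distrib]
  rw [← Fintype.prod_sum (fun i j => pauli (p i) (x i) j * pauli (q i) j (y i))]
  refine Finset.prod_congr rfl fun i _ => ?_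
  have := congrFun (congrFun (h (p i) (q i)) (x i)) (y i)
  rwa [Matrix.mul_apply, Matrix.smul_apply, smul_eq_mul] at this

theorem pauliString_conjTranspose {n : ℕ} (p : Fin n → Fin 4) :
    (pauliString p).conjTranspose = pauliString p := by
  ext x y
  simp only [Matrix.conjTranspose_apply, pauliString, Matrix.of_apply, star_prod]
  refine Finset.prod_congr rfl fun i _ => ?_
  exact congrFun (congrFun (pauli_conjTranspose (p i)) (x i)) (y i)

/-- The `n`-qubit Pauli group: the Pauli strings times the phases `±1, ±i`. -/
def pauliGroup (n : ℕ) : Subgroup (QubitUnitary n) where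
  carrier := {U | ∃ (e : ℕ) (p : Fin n → Fin 4),
    (U : Matrix (Fin n → Fin 2) (Fin n → Fin 2) ℂ) = Complex.I ^ e • pauliString p}
  one_mem' := ⟨0, 0, by simp [pauliString_zero]⟩
  mul_mem' := by
    rintro U V ⟨e, p, hU⟩ ⟨f, q, hV⟩
    obtain ⟨g, r, h⟩ := pauliString_mul p q
    refine ⟨e + f + g, r, ?_⟩
    rw [Submonoid.coe_mul, hU, hV, Matrix.smul_mul, Matrix.mul_smul, h, smul_smul, smul_smul,
      pow_add, pow_add, mul_assoc]
  inv_mem' := by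
    rintro U ⟨e, p, hU⟩
    refine ⟨3 * e, p, ?_⟩
    have h1 : ((U⁻¹ : QubitUnitary n) : Matrix (Fin n → Fin 2) (Fin n → Fin 2) ℂ)
        = (U : Matrix (Fin n → Fin 2) (Fin n → Fin 2) ℂ).conjTranspose := rfl
    rw [h1, hU, Matrix.conjTranspose_smul, pauliString_conjTranspose, pow_mul]
    simp [Complex.I_pow_three]

/-- The `n`-qubit Clifford group: the normalizer of the Pauli group in the unitary group. -/
def cliffordGroup (n : ℕ) : Subgroup (QubitUnitary n) :=
  Subgroup.normalizer (pauliGroup n : Set (QubitUnitary n))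

theorem pauliGroup_finite (n : ℕ) : (pauliGroup n : Set (QubitUnitary n)).Finite := by
  have hfin : (Set.range fun z : Fin 4 × (Fin n → Fin 4) =>
      Complex.I ^ (z.1 : ℕ) • pauliString z.2).Finite := Set.finite_range _
  refine Set.Finite.of_finite_image (f := Subtype.val) (hfin.subset ?_)
    Subtype.val_injective.injOn
  rintro _ ⟨U, ⟨e, p, hU⟩, rfl⟩
  refine ⟨(⟨e % 4, Nat.mod_lt _ (by norm_num)⟩, p), ?_⟩
  rw [hU]
  simp only
  rw [← Complex.I_pow_eq_pow_mod]

theorem isClosed_preimage_conj (n : ℕ) (P : QubitUnitary n) :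
    IsClosed {g : QubitUnitary n | g * P * g⁻¹ ∈ pauliGroup n} := by
  have hc : Continuous fun g : QubitUnitary n => g * P * g⁻¹ :=
    (continuous_id.mul continuous_const).mul continuous_inv
  exact (pauliGroup_finite n).isClosed.preimage hc

theorem cliffordGroup_eq_iInter (n : ℕ) : (cliffordGroup n : Set (QubitUnitary n))
    = ⋂ P ∈ pauliGroup n, ({g : QubitUnitary n | g * P * g⁻¹ ∈ pauliGroup n}
      ∩ (fun g => g⁻¹) ⁻¹' {g : QubitUnitary n | g * P * g⁻¹ ∈ pauliGroup n}) := by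
  ext g
  simp only [Set.mem_iInter, Set.mem_inter_iff, Set.mem_preimage, Set.mem_ofPred_eq, inv_inv,
    SetLike.mem_coe]
  constructor
  · intro h P hP
    refine ⟨(h P).1 hP, (h (g⁻¹ * P * g)).2 ?_⟩
    have : g * (g⁻¹ * P * g) * g⁻¹ = P := by group
    rw [this]
    exact hP
  · intro h P
    refine ⟨fun hP => (h P hP).1, fun hP => ?_⟩
    have : g⁻¹ * (g * P * g⁻¹) * g = P := by group
    rw [SetLike.mem_coe, ← this]
    exact (h _ hP).2

instance (n : ℕ) : CompactSpace (cliffordGroup n) := by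
  have h : IsClosed (cliffordGroup n : Set (QubitUnitary n)) := by
    rw [cliffordGroup_eq_iInter]
    exact isClosed_biInter fun P _ => ((isClosed_preimage_conj n P).inter
      ((isClosed_preimage_conj n P).preimage continuous_inv))
  exact isCompact_iff_compactSpace.mp h.isCompact

/-! ### One-dimensional circuits of 2-local Clifford gates -/

/-- `A = W ⊗ 𝟙` with `W` acting on the qubits in `S` and `𝟙` on the others. -/
def ActsOn {n : ℕ} (S : Finset (Fin n)) (A : Matrix (Fin n → Fin 2) (Fin n → Fin 2) ℂ) : Prop :=
  ∃ W : Matrix (S → Fin 2) (S → Fin 2) ℂ, ∀ x y : Fin n → Fin 2,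
    A x y = if ∀ i, i ∉ S → x i = y i then W (fun i => x i) (fun i => y i) else 0

/-- A 2-local Clifford gate on a line of `n` qubits, with its location `S`: a Clifford unitary that
acts on `S` only, where `S` consists of two neighbouring qubits (or of a single qubit, when
`i = j`). -/
def IsLocalCliffordGate {n : ℕ} (S : Finset (Fin n)) (g : QubitUnitary n) : Prop :=
  g ∈ cliffordGroup n ∧ (∃ i j : Fin n, (j = i ∨ j.val = i.val + 1) ∧ S = {i, j}) ∧ ActsOn S g.val

/-- One layer of a circuit: gates applied in parallel, that is, on pairwise disjoint locations. -/
def IsLayer {n : ℕ} (U : QubitUnitary n) : Prop :=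
  ∃ gates : List (Finset (Fin n) × QubitUnitary n),
    (∀ g ∈ gates, IsLocalCliffordGate g.1 g.2) ∧
    gates.Pairwise (fun g h => Disjoint g.1 h.1) ∧
    U = (gates.map Prod.snd).prod

/-- `U` is implemented by a depth-`L` circuit of 2-local Clifford gates on a line of `n` qubits:
it is a product of `L` layers. As a layer may be empty, smaller depths are included. -/
def IsCliffordCircuit {n : ℕ} (L : ℕ) (U : QubitUnitary n) : Prop :=
  ∃ layers : List (QubitUnitary n),
    layers.length = L ∧ (∀ V ∈ layers, IsLayer V) ∧ U = layers.prod

end CliffordDesign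

end

/-! A single experiment tells shallow circuits from Haar-random Cliffords. Prepare the eight copies
as four maximally entangled pairs, with the Pauli `Z` of the first qubit applied to one half of the
first pair. Apply `U^{⊗8}`, then measure whether the outcome lies in the joint +1 eigenspace of
`X^{⊗8}`, `Y^{⊗8}`, `Z^{⊗8}` on the last qubit. For Clifford `U` the operator `U† P U` is a Pauli
string up to phase, hence equal to its transpose up to sign; the signs cancel over the four pairs,
and the expectation of `P^{⊗8}` is the out-of-time-order correlator `otoc Z P U`, which is 1 if `P`
commutes with `U Z U†` (`trace_tensorPow_mul_conjPow_probeState`).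

If `L < n - 1`, the light cone of the first qubit misses the last one, so `U Z U†` commutes with
every Pauli there and the reflection `commutationReflection` has expectation exactly 1
(`IsCliffordCircuit.commute_pauliString`). Under Haar measure all nontrivial Pauli strings have the
same mean correlator. The sum over all strings vanishes because `Z` is traceless, and the identity
contributes 1, so each nontrivial mean is `-1/(4^n - 1)` (`integral_otoc`). The reflection then has
mean `-1/2 - (3/2)/(4^n - 1)`.

The two values differ by strictly more than 3/2. A unitary observable bounds the diamond norm from
below (`ofReal_norm_trace_mul_le_diamondNorm`), so `ε ≤ 3/2` is impossible. -/

noncomputable section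

namespace CliffordDesign

/-! ### Lower bounds on the trace and diamond norms from unitary observables -/

section TraceNorm

variable {X : Type*} [Fintype X] [DecidableEq X]

omit [DecidableEq X] in
theorem conjTranspose_mul_self_apply_self (M : Matrix X X ℂ) (i : X) :
    (M.conjTranspose * M) i i = ((∑ k, ‖M k i‖ ^ 2 : ℝ) : ℂ) := by
  simp only [Matrix.mul_apply, Matrix.conjTranspose_apply, Complex.ofReal_sum]
  refine Finset.sum_congr rfl fun k _ => ?_
  rw [Complex.star_def, ← Complex.normSq_eq_conj_mul_self, Complex.normSq_eq_norm_sq]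

/-- Duality between the trace norm and the operator norm, for a unitary observable. -/
theorem norm_trace_mul_le_traceNorm {N : Matrix X X ℂ} (hN : N ∈ Matrix.unitaryGroup X ℂ)
    (A : Matrix X X ℂ) : ‖(N * A).trace‖ ≤ traceNorm A := by
  set h := Matrix.isHermitian_conjTranspose_mul_self A with hh
  set V : Matrix X X ℂ := (h.eigenvectorUnitary : Matrix X X ℂ) with hV
  have hVV : V * V.conjTranspose = 1 := Matrix.mem_unitaryGroup_iff.1 h.eigenvectorUnitary.2
  have hVV' : V.conjTranspose * V = 1 := Matrix.mem_unitaryGroup_iff'.1 h.eigenvectorUnitary.2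
  have hNN' : N * N.conjTranspose = 1 := Matrix.mem_unitaryGroup_iff.1 hN
  have hdiag : (A * V).conjTranspose * (A * V)
      = Matrix.diagonal (fun i => ((h.eigenvalues i : ℝ) : ℂ)) := by
    have := h.conjStarAlgAut_star_eigenvectorUnitary
    rw [Unitary.conjStarAlgAut_apply] at this
    simp only [Unitary.coe_star, star_star] at this
    rw [Matrix.conjTranspose_mul, Matrix.mul_assoc, ← Matrix.mul_assoc A.conjTranspose,
      ← Matrix.mul_assoc]
    exact this
  have hcol : ∀ i, ∑ k, ‖(A * V) k i‖ ^ 2 = h.eigenvalues i := by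
    intro i
    have := conjTranspose_mul_self_apply_self (A * V) i
    rw [hdiag, Matrix.diagonal_apply_eq] at this
    exact_mod_cast this.symm
  have hrow : ∀ i, ∑ k, ‖(V.conjTranspose * N) i k‖ ^ 2 = 1 := by
    intro i
    have hM : (V.conjTranspose * N) * (V.conjTranspose * N).conjTranspose = 1 := by
      rw [Matrix.conjTranspose_mul, Matrix.conjTranspose_conjTranspose, Matrix.mul_assoc,
        ← Matrix.mul_assoc N, hNN', Matrix.one_mul, hVV']
    generalize V.conjTranspose * N = M at hM ⊢
    have := conjTranspose_mul_self_apply_self M.conjTranspose i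
    rw [Matrix.conjTranspose_conjTranspose, hM, Matrix.one_apply_eq] at this
    simp only [Matrix.conjTranspose_apply, norm_star] at this
    exact_mod_cast this.symm
  -- In the eigenbasis of `A† A` the columns of `A V` have the singular values as lengths, while the
  -- rows of `V† N` are unit vectors; Cauchy–Schwarz on each diagonal entry finishes.
  have htr : (N * A).trace = ((V.conjTranspose * N) * (A * V)).trace := by
    rw [Matrix.trace_mul_comm (V.conjTranspose * N), Matrix.mul_assoc, ← Matrix.mul_assoc V,
      hVV, Matrix.one_mul, Matrix.trace_mul_comm]
  rw [htr, Matrix.trace]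
  refine (norm_sum_le _ _).trans (Finset.sum_le_sum fun i _ => ?_)
  rw [Matrix.diag_apply, Matrix.mul_apply]
  refine (norm_sum_le _ _).trans ?_
  simp only [norm_mul]
  refine (Real.sum_mul_le_sqrt_mul_sqrt _ _ _).trans ?_
  rw [hrow, hcol, Real.sqrt_one, one_mul]

/-- The distinguishing experiment needs no ancilla, so the supremum is tested at ancilla dimension
1, where the extra factor is only a relabelling of indices. -/
theorem ofReal_norm_trace_mul_le_diamondNorm (Φ : Matrix X X ℂ →ₗ[ℂ] Matrix X X ℂ)
    {N ρ : Matrix X X ℂ} (hN : N ∈ Matrix.unitaryGroup X ℂ) (hρ : IsState ρ) :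
    ENNReal.ofReal ‖(N * Φ ρ).trace‖ ≤ diamondNorm Φ := by
  let e : X × Fin 1 ≃ X := Equiv.prodUnique X (Fin 1)
  have hρ' : IsState (ρ.submatrix e e) := by
    refine ⟨hρ.1.submatrix e, ?_⟩
    rw [← hρ.2]
    exact e.sum_comp fun x => ρ x x
  have hN' : N.submatrix e e ∈ Matrix.unitaryGroup (X × Fin 1) ℂ := by
    rw [Matrix.mem_unitaryGroup_iff, Matrix.star_eq_conjTranspose, Matrix.conjTranspose_submatrix,
      Matrix.submatrix_mul_equiv, ← Matrix.star_eq_conjTranspose,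
      Matrix.mem_unitaryGroup_iff.1 hN, Matrix.submatrix_one_equiv]
  have hout : tensorId Φ (ρ.submatrix e e) = (Φ ρ).submatrix e e := rfl
  have htr : (N.submatrix e e * tensorId Φ (ρ.submatrix e e)).trace = (N * Φ ρ).trace := by
    rw [hout, Matrix.submatrix_mul_equiv]
    exact e.sum_comp fun x => (N * Φ ρ) x x
  have hle := norm_trace_mul_le_traceNorm hN' (tensorId Φ (ρ.submatrix e e))
  rw [htr] at hle
  refine (ENNReal.ofReal_le_ofReal hle).trans ?_
  exact le_iSup_of_le 1 (le_iSup_of_le (ρ.submatrix e e) (le_iSup_of_le hρ' le_rfl))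

end TraceNorm

/-! ### Tensor powers, moment channels and product states of four pairs -/

section TensorPow

variable {X : Type*} [Fintype X] [DecidableEq X]

omit [DecidableEq X] in
theorem tensorPow_mul (k : ℕ) (A B : Matrix X X ℂ) :
    tensorPow k (A * B) = tensorPow k A * tensorPow k B := by
  ext x y
  simp only [tensorPow, Matrix.of_apply, Matrix.mul_apply]
  rw [Fintype.prod_sum]
  simp only [Finset.prod_mul_distrib]

omit [Fintype X] in
theorem tensorPow_one (k : ℕ) : tensorPow k (1 : Matrix X X ℂ) = 1 := by
  ext x y
  simp only [tensorPow, Matrix.of_apply, Matrix.one_apply, funext_iff]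
  rw [Finset.prod_ite_zero]
  simp

omit [Fintype X] [DecidableEq X] in
theorem tensorPow_smul (k : ℕ) (c : ℂ) (A : Matrix X X ℂ) :
    tensorPow k (c • A) = c ^ k • tensorPow k A := by
  ext x y
  simp [tensorPow, Finset.prod_mul_distrib]

omit [Fintype X] [DecidableEq X] in
theorem tensorPow_conjTranspose (k : ℕ) (A : Matrix X X ℂ) :
    tensorPow k A.conjTranspose = (tensorPow k A).conjTranspose := by
  ext x y
  simp [tensorPow]

-- Heisenberg picture: by cyclicity the evolution moves from the state to the observable.
omit [DecidableEq X] in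
theorem trace_tensorPow_mul_conjPow (k : ℕ) (P U : Matrix X X ℂ)
    (ρ : Matrix (Fin k → X) (Fin k → X) ℂ) :
    (tensorPow k P * conjPow k U ρ).trace = (tensorPow k (U.conjTranspose * P * U) * ρ).trace := by
  rw [conjPow, ← Matrix.mul_assoc, Matrix.trace_mul_comm, ← Matrix.mul_assoc, ← Matrix.mul_assoc,
    tensorPow_mul, tensorPow_mul]

theorem trace_mul_momentChannel (k : ℕ) (ℰ : Measure (Matrix.unitaryGroup X ℂ)) [IsFiniteMeasure ℰ]
    (N ρ : Matrix (Fin k → X) (Fin k → X) ℂ) :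
    (N * momentChannel k ℰ ρ).trace
      = ∫ U : Matrix.unitaryGroup X ℂ, (N * conjPow k (U : Matrix X X ℂ) ρ).trace ∂ℰ := by
  simp only [Matrix.trace, Matrix.diag_apply, Matrix.mul_apply]
  have hint : ∀ x y, Integrable
      (fun U : Matrix.unitaryGroup X ℂ => N x y * conjPow k (U : Matrix X X ℂ) ρ y x) ℰ :=
    fun x y => (integrable_conjPow k ℰ ρ y x).const_mul _
  refine Eq.trans ?_ (integral_finsetSum _ fun x _ => integrable_finsetSum _ fun y _ =>
    hint x y).symm
  refine Finset.sum_congr rfl fun x _ => ?_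
  refine Eq.trans ?_ (integral_finsetSum _ fun y _ => hint x y).symm
  refine Finset.sum_congr rfl fun y _ => ?_
  exact (integral_const_mul _ _).symm

/-- The eight tensor factors, grouped into four pairs. -/
def pairIndex : Fin 4 × Fin 2 ≃ Fin 8 := finProdFinEquiv

/-- Multi-indices of eight systems as multi-indices of four pairs. -/
def pairEquiv (X : Type*) : (Fin 8 → X) ≃ (Fin 4 → X × X) where
  toFun x k := (x (pairIndex (k, 0)), x (pairIndex (k, 1)))
  invFun u j := if (pairIndex.symm j).2 = 0 then (u (pairIndex.symm j).1).1
    else (u (pairIndex.symm j).1).2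
  left_inv x := by
    ext j
    obtain ⟨⟨k, i⟩, rfl⟩ := pairIndex.surjective j
    fin_cases i <;> simp
  right_inv u := by
    ext k <;> simp

/-- The vector `⨂ₖ ∑ A k a b |a b⟩` in the eightfold tensor power. -/
def pairVector (A : Fin 4 → Matrix X X ℂ) (x : Fin 8 → X) : ℂ :=
  ∏ k, A k (pairEquiv X x k).1 (pairEquiv X x k).2

omit [Fintype X] [DecidableEq X] in
theorem tensorPow_eight_apply (B : Matrix X X ℂ) (x y : Fin 8 → X) :
    tensorPow 8 B x y = ∏ k, B (pairEquiv X x k).1 (pairEquiv X y k).1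
      * B (pairEquiv X x k).2 (pairEquiv X y k).2 := by
  rw [tensorPow, Matrix.of_apply, ← pairIndex.prod_comp, Fintype.prod_prod_type]
  simp only [Fin.prod_univ_two]
  rfl

omit [DecidableEq X] in
theorem trace_mul_conjTranspose_mul_transpose (A B : Matrix X X ℂ) :
    (A.conjTranspose * B * A * B.transpose).trace
      = ∑ a : X × X, ∑ b : X × X, B a.1 b.1 * B a.2 b.2 * (A b.1 b.2 * star (A a.1 a.2)) := by
  have h1 : (A.conjTranspose * B * A * B.transpose).trace
      = ∑ d, ∑ c, ∑ b, ∑ a, B a b * B d c * (A b c * star (A a d)) := by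
    simp only [Matrix.trace, Matrix.diag_apply, Matrix.mul_apply, Finset.sum_mul,
      Matrix.conjTranspose_apply, Matrix.transpose_apply]
    refine Finset.sum_congr rfl fun d _ => Finset.sum_congr rfl fun c _ =>
      Finset.sum_congr rfl fun b _ => Finset.sum_congr rfl fun a _ => by ring
  simp only [h1, Fintype.sum_prod_type]
  have h2 : ∀ d, ∑ c, ∑ b, ∑ a, B a b * B d c * (A b c * star (A a d))
      = ∑ a, ∑ b, ∑ c, B a b * B d c * (A b c * star (A a d)) := by
    intro d
    rw [Finset.sum_comm]
    exact (Finset.sum_congr rfl fun b _ => Finset.sum_comm).trans Finset.sum_comm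
  simp only [h2]
  rw [Finset.sum_comm]

-- A matrix `A` read as a vector of a pair satisfies `⟨A| B ⊗ B |A⟩ = Tr(A† B A Bᵀ)`, and both the
-- state and the observable factor over the four pairs.
omit [DecidableEq X] in
theorem trace_tensorPow_mul_pairVector (A : Fin 4 → Matrix X X ℂ) (B : Matrix X X ℂ) :
    (tensorPow 8 B * Matrix.vecMulVec (pairVector A) (star (pairVector A))).trace
      = ∏ k, ((A k).conjTranspose * B * A k * B.transpose).trace := by
  simp only [trace_mul_conjTranspose_mul_transpose]
  rw [Fintype.prod_sum]
  simp only [Fintype.prod_sum]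
  simp only [Matrix.trace, Matrix.diag_apply, Matrix.mul_apply]
  rw [← (pairEquiv X).sum_comp]
  refine Finset.sum_congr rfl fun x _ => ?_
  rw [← (pairEquiv X).sum_comp]
  refine Finset.sum_congr rfl fun y _ => ?_
  rw [tensorPow_eight_apply, Matrix.vecMulVec_apply, Pi.star_apply, pairVector, pairVector,
    star_prod, ← Finset.prod_mul_distrib, ← Finset.prod_mul_distrib]

theorem isState_pairVector (A : Fin 4 → Matrix X X ℂ)
    (hA : ∀ k, ((A k).conjTranspose * A k).trace = 1) :
    IsState (Matrix.vecMulVec (pairVector A) (star (pairVector A))) := by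
  refine ⟨Matrix.posSemidef_vecMulVec_self_star _, ?_⟩
  have := trace_tensorPow_mul_pairVector A 1
  rw [tensorPow_one, Matrix.one_mul] at this
  rw [this]
  simp [hA]

end TensorPow

/-! ### Commutation signs and sums over Pauli strings -/

section Pauli

variable {n : ℕ}

/-- The sign `±1` with `pauli a * pauli b = pauliSign a b • (pauli b * pauli a)`. -/
def pauliSign (a b : Fin 4) : ℤ := if a = 0 ∨ b = 0 ∨ a = b then 1 else -1

theorem pauliSign_eq_one_or (a b : Fin 4) : pauliSign a b = 1 ∨ pauliSign a b = -1 := by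
  unfold pauliSign; split_ifs <;> simp

theorem pauli_mul_comm (a b : Fin 4) :
    pauli a * pauli b = (pauliSign a b : ℂ) • (pauli b * pauli a) := by
  fin_cases a <;> fin_cases b <;> ext i j <;> fin_cases i <;> fin_cases j <;>
    simp [pauli, pauliSign]

theorem pauli_transpose (a : Fin 4) :
    ∃ s : ℂ, s * s = 1 ∧ (pauli a).transpose = s • pauli a := by
  by_cases h : a = 2
  · refine ⟨-1, by simp, ?_⟩
    subst h
    ext i j
    fin_cases i <;> fin_cases j <;> simp [pauli]
  · refine ⟨1, by simp, ?_⟩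
    fin_cases a <;> ext i j <;> fin_cases i <;> fin_cases j <;> simp [pauli] at h ⊢

theorem trace_pauli {a : Fin 4} (ha : a ≠ 0) : (pauli a).trace = 0 := by
  fin_cases a <;> simp [pauli, Matrix.trace_fin_two] at ha ⊢

/-- This is `∑ P ⊗ P = 2 · SWAP` in coordinates, the source of the twirl identity for strings. -/
theorem sum_pauli_mul_pauli (x y z w : Fin 2) :
    ∑ a, pauli a x y * pauli a z w = if x = w ∧ y = z then 2 else 0 := by
  fin_cases x <;> fin_cases y <;> fin_cases z <;> fin_cases w <;>
    simp [pauli, Fin.sum_univ_four] <;> norm_num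

theorem pauliString_mul_of_forall {p q r : Fin n → Fin 4} {s : Fin n → ℂ}
    (h : ∀ i, pauli (p i) * pauli (q i) = s i • pauli (r i)) :
    pauliString p * pauliString q = (∏ i, s i) • pauliString r := by
  ext x y
  simp only [Matrix.mul_apply, Matrix.smul_apply, pauliString, Matrix.of_apply, smul_eq_mul]
  simp_rw [← Finset.prod_mul_distrib]
  rw [← Fintype.prod_sum (fun i j => pauli (p i) (x i) j * pauli (q i) j (y i))]
  refine Finset.prod_congr rfl fun i _ => ?_
  have := congrFun (congrFun (h i) (x i)) (y i)
  rwa [Matrix.mul_apply, Matrix.smul_apply, smul_eq_mul] at this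

/-- The commutation sign of two Pauli strings. -/
def stringSign (p q : Fin n → Fin 4) : ℤ := ∏ i, pauliSign (p i) (q i)

theorem stringSign_eq_one_or (p q : Fin n → Fin 4) : stringSign p q = 1 ∨ stringSign p q = -1 := by
  unfold stringSign
  refine Finset.prod_induction _ (fun s : ℤ => s = 1 ∨ s = -1) ?_ (Or.inl rfl) fun i _ =>
    pauliSign_eq_one_or _ _
  rintro a b (rfl | rfl) (rfl | rfl) <;> simp

theorem pauliString_mul_comm (p q : Fin n → Fin 4) :
    pauliString p * pauliString q = (stringSign p q : ℂ) • (pauliString q * pauliString p) := by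
  ext x y
  simp only [Matrix.mul_apply, Matrix.smul_apply, pauliString, Matrix.of_apply, smul_eq_mul,
    stringSign, Int.cast_prod]
  simp_rw [← Finset.prod_mul_distrib]
  rw [← Fintype.prod_sum (fun i j => pauli (p i) (x i) j * pauli (q i) j (y i)),
    ← Fintype.prod_sum (fun i j => pauli (q i) (x i) j * pauli (p i) j (y i)),
    ← Finset.prod_mul_distrib]
  refine Finset.prod_congr rfl fun i _ => ?_
  have := congrFun (congrFun (pauli_mul_comm (p i) (q i)) (x i)) (y i)
  rwa [Matrix.mul_apply, Matrix.smul_apply, Matrix.mul_apply, smul_eq_mul] at this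

theorem pauliString_mul_self (p : Fin n → Fin 4) : pauliString p * pauliString p = 1 := by
  rw [pauliString_mul_of_forall (r := 0) (s := fun _ => 1), pauliString_zero]
  · simp
  · intro i
    generalize p i = a
    fin_cases a <;> ext i j <;> fin_cases i <;> fin_cases j <;> simp [pauli]

theorem pauliString_transpose (p : Fin n → Fin 4) :
    ∃ s : ℂ, s * s = 1 ∧ (pauliString p).transpose = s • pauliString p := by
  choose s hs h using pauli_transpose
  refine ⟨∏ i, s (p i), ?_, ?_⟩
  · rw [← Finset.prod_mul_distrib]
    exact Finset.prod_eq_one fun i _ => hs _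
  · ext x y
    simp only [Matrix.transpose_apply, pauliString, Matrix.of_apply, Matrix.smul_apply,
      smul_eq_mul]
    rw [← Finset.prod_mul_distrib]
    refine Finset.prod_congr rfl fun i _ => ?_
    exact congrFun (congrFun (h (p i)) (x i)) (y i)

theorem trace_pauliString {p : Fin n → Fin 4} (hp : p ≠ 0) : (pauliString p).trace = 0 := by
  obtain ⟨i, hi⟩ := Function.ne_iff.1 hp
  simp only [Matrix.trace, Matrix.diag_apply, pauliString, Matrix.of_apply]
  rw [← Fintype.prod_sum (fun i j => pauli (p i) j j)]
  exact Finset.prod_eq_zero (Finset.mem_univ i) (trace_pauli hi)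

theorem sum_pauliString_mul_pauliString (x y z w : Fin n → Fin 2) :
    ∑ p : Fin n → Fin 4, pauliString p x y * pauliString p z w
      = if x = w ∧ y = z then 2 ^ n else 0 := by
  simp only [pauliString, Matrix.of_apply]
  simp_rw [← Finset.prod_mul_distrib]
  rw [← Fintype.prod_sum (fun i a => pauli a (x i) (y i) * pauli a (z i) (w i))]
  simp only [sum_pauli_mul_pauli]
  rw [Finset.prod_ite_zero]
  simp [funext_iff, forall_and]

/-- The twirl over all Pauli strings is completely depolarizing. -/
theorem sum_trace_pauliString_conj (R : Matrix (Fin n → Fin 2) (Fin n → Fin 2) ℂ) :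
    ∑ p, (pauliString p * R * pauliString p * R).trace = 2 ^ n * R.trace ^ 2 := by
  have h : ∀ p : Fin n → Fin 4, (pauliString p * R * pauliString p * R).trace
      = ∑ x, ∑ w, ∑ z, ∑ y,
        (R y z * R w x) * (pauliString p x y * pauliString p z w) := by
    intro p
    simp only [Matrix.trace, Matrix.diag_apply, Matrix.mul_apply, Finset.sum_mul]
    refine Finset.sum_congr rfl fun _ _ => Finset.sum_congr rfl fun _ _ =>
      Finset.sum_congr rfl fun _ _ => Finset.sum_congr rfl fun _ _ => by ring
  simp only [h]
  rw [Finset.sum_comm]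
  have h2 : ∀ x, ∑ p : Fin n → Fin 4, ∑ w, ∑ z, ∑ y,
        (R y z * R w x) * (pauliString p x y * pauliString p z w)
      = ∑ w, ∑ z, ∑ y, (R y z * R w x) *
          ∑ p : Fin n → Fin 4, (pauliString p x y * pauliString p z w) := by
    intro x
    simp only [Finset.mul_sum]
    rw [Finset.sum_comm]
    refine Finset.sum_congr rfl fun w _ => ?_
    rw [Finset.sum_comm]
    refine Finset.sum_congr rfl fun z _ => ?_
    rw [Finset.sum_comm]
  have h3 : ∀ x : Fin n → Fin 2, ∑ w, ∑ z, ∑ y, (R y z * R w x) *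
      (if x = w ∧ y = z then (2 ^ n : ℂ) else 0) = 2 ^ n * (R x x * R.trace) := by
    intro x
    rw [Finset.sum_eq_single x (fun w _ hw => by simp [hw.symm]) (by simp), Matrix.trace,
      Finset.mul_sum, Finset.mul_sum]
    refine Finset.sum_congr rfl fun z _ => ?_
    rw [Finset.sum_eq_single z (fun y _ hy => by simp [hy]) (by simp), Matrix.diag_apply]
    simp only [true_and, if_true]
    ring
  simp only [h2, sum_pauliString_mul_pauliString, h3]
  rw [← Finset.mul_sum, ← Finset.sum_mul, pow_two]
  rfl

theorem exists_pauliSign_eq_neg_one {a : Fin 4} (ha : a ≠ 0) : ∃ b, pauliSign a b = -1 := by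
  revert a; decide

/-- If `a ≠ b`, the third Pauli matrix works; if `a = b`, either of the other two does. -/
theorem exists_pauliSign_eq_neg_one₂ {a b : Fin 4} (ha : a ≠ 0) (hb : b ≠ 0) :
    ∃ c, pauliSign a c = -1 ∧ pauliSign b c = -1 := by
  revert a b; decide

theorem stringSign_single (p : Fin n → Fin 4) (i : Fin n) (a : Fin 4) :
    stringSign p (Pi.single i a) = pauliSign (p i) a := by
  unfold stringSign
  rw [Finset.prod_eq_single i, Pi.single_eq_same]
  · intro j _ hj
    simp [Pi.single_eq_of_ne hj, pauliSign]
  · simp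

theorem stringSign_update {p : Fin n → Fin 4} {i j : Fin n} (hij : i ≠ j) (a b : Fin 4) :
    stringSign p (Function.update (Pi.single i a) j b)
      = pauliSign (p i) a * pauliSign (p j) b := by
  unfold stringSign
  rw [← Finset.mul_prod_erase _ _ (Finset.mem_univ j), mul_comm, Function.update_self,
    ← stringSign_single p i a]
  congr 1
  refine Eq.trans ?_ (Finset.mul_prod_erase Finset.univ
    (fun k => pauliSign (p k) ((Pi.single i a : Fin n → Fin 4) k)) (Finset.mem_univ j))
  rw [Pi.single_eq_of_ne hij.symm]
  simp only [pauliSign, true_or, or_true, if_true, one_mul]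
  refine Finset.prod_congr rfl fun k hk => ?_
  rw [Function.update_of_ne (Finset.ne_of_mem_erase hk)]

/-- Any two nontrivial Pauli strings anticommute with a common Pauli string. -/
theorem exists_stringSign_eq_neg_one {p q : Fin n → Fin 4} (hp : p ≠ 0) (hq : q ≠ 0) :
    ∃ r, stringSign p r = -1 ∧ stringSign q r = -1 := by
  obtain ⟨i, hi⟩ := Function.ne_iff.1 hp
  obtain ⟨j, hj⟩ := Function.ne_iff.1 hq
  simp only [Pi.zero_apply] at hi hj
  by_cases hqi : q i = 0
  · by_cases hpj : p j = 0
    · have hij : i ≠ j := by rintro rfl; exact hj hqi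
      obtain ⟨a, ha⟩ := exists_pauliSign_eq_neg_one hi
      obtain ⟨b, hb⟩ := exists_pauliSign_eq_neg_one hj
      -- Here `p` is trivial at `j` and `q` is trivial at `i`, so the two sites can be chosen
      -- independently. In the other cases one site where both are nontrivial suffices.
      refine ⟨Function.update (Pi.single i a) j b, ?_, ?_⟩
      · rw [stringSign_update hij, ha, hpj]; simp [pauliSign]
      · rw [stringSign_update hij, hb, hqi]; simp [pauliSign]
    · obtain ⟨c, hc, hc'⟩ := exists_pauliSign_eq_neg_one₂ hpj hj
      exact ⟨Pi.single j c, by rwa [stringSign_single], by rwa [stringSign_single]⟩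
  · obtain ⟨c, hc, hc'⟩ := exists_pauliSign_eq_neg_one₂ hi hqi
    exact ⟨Pi.single i c, by rwa [stringSign_single], by rwa [stringSign_single]⟩

theorem pauliString_single_mul {i : Fin n} {a b c : Fin 4} {s : ℂ}
    (h : pauli a * pauli b = s • pauli c) :
    pauliString (Pi.single i a) * pauliString (Pi.single i b)
      = s • pauliString (Pi.single i c) := by
  rw [pauliString_mul_of_forall (r := Pi.single i c) (s := fun j => if j = i then s else 1)]
  · simp
  · intro j
    by_cases hj : j = i
    · subst hj; simpa using h
    · simp [hj, pauli]

end Pauli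

/-! ### Clifford averages of the out-of-time-order correlator -/

section Twirl

variable {n : ℕ}

theorem exists_sign_smul_mul_comm (p q : Fin n → Fin 4) :
    ∃ s : ℂ, (s = 1 ∨ s = -1) ∧
      pauliString p * pauliString q = s • (pauliString q * pauliString p) := by
  refine ⟨stringSign p q, ?_, pauliString_mul_comm p q⟩
  rcases stringSign_eq_one_or p q with h | h <;> simp [h]

/-- For anticommuting Pauli strings `P` and `Q`, the operator `(P + Q) / √2` is a Clifford unitary
which exchanges `P` and `Q` under conjugation. -/
theorem exists_mem_cliffordGroup_conj {p q : Fin n → Fin 4} (hpq : stringSign p q = -1) :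
    ∃ h ∈ cliffordGroup n,
      (h : Matrix (Fin n → Fin 2) (Fin n → Fin 2) ℂ).conjTranspose * pauliString p * h
        = pauliString q := by
  set P := pauliString p with hP
  set Q := pauliString q with hQ
  have hPP : P * P = 1 := pauliString_mul_self p
  have hQQ : Q * Q = 1 := pauliString_mul_self q
  have hPQ : Q * P = -(P * Q) := by
    have := pauliString_mul_comm p q
    rw [hpq] at this
    rw [hP, hQ, this]
    simp
  obtain ⟨c, hc, hcs⟩ : ∃ c : ℂ, c * c = 1 / 2 ∧ star c = c := by
    refine ⟨((√2)⁻¹ : ℝ), ?_, by simp⟩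
    rw [← Complex.ofReal_mul, ← mul_inv, Real.mul_self_sqrt (by norm_num)]
    simp
  set H : Matrix (Fin n → Fin 2) (Fin n → Fin 2) ℂ := c • (P + Q) with hH
  have hHs : H.conjTranspose = H := by
    rw [hH, Matrix.conjTranspose_smul, hcs, Matrix.conjTranspose_add, hP, hQ,
      pauliString_conjTranspose, pauliString_conjTranspose]
  have hHH : H * H = 1 := by
    rw [hH, Matrix.smul_mul, Matrix.mul_smul, smul_smul, hc, add_mul, mul_add, mul_add, hPP, hQQ,
      hPQ]
    module
  have hconj : H * P * H = Q := by
    rw [hH, Matrix.smul_mul, Matrix.smul_mul, Matrix.mul_smul, smul_smul, hc]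
    have : (P + Q) * P * (P + Q) = P * P * P + P * P * Q + Q * P * P + Q * P * Q := by
      noncomm_ring
    rw [this, mul_assoc Q P P, hPP, hPQ, neg_mul, mul_assoc P Q Q, hQQ, one_mul, one_mul, mul_one,
      mul_one]
    module
  have hmem : H ∈ Matrix.unitaryGroup (Fin n → Fin 2) ℂ := by
    rw [Matrix.mem_unitaryGroup_iff, Matrix.star_eq_conjTranspose, hHs, hHH]
  have hpauli : ∀ r : Fin n → Fin 4, ∃ (e : ℕ) (t : Fin n → Fin 4),
      H * pauliString r * H = Complex.I ^ e • pauliString t := by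
    intro r
    obtain ⟨s, hs, hsr⟩ := exists_sign_smul_mul_comm r p
    obtain ⟨s', hs', hsr'⟩ := exists_sign_smul_mul_comm r q
    rw [← hP] at hsr
    rw [← hQ] at hsr'
    -- Moving `R` to the right past `P` and `Q` produces the signs `s`, `s'`. Equal signs leave
    -- `±R`, opposite signs leave `±P Q R`; both are Pauli strings up to phase, so `H` normalizes
    -- the Pauli group.
    have key : H * pauliString r * H
        = (1 / 2 : ℂ) • (((s + s') • (1 : Matrix _ _ ℂ) + (s' - s) • (P * Q)) * pauliString r) := by
      rw [hH, Matrix.smul_mul, Matrix.smul_mul, Matrix.mul_smul, smul_smul, hc, mul_assoc, mul_add,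
        hsr, hsr']
      congr 1
      have : (P + Q) * (s • (P * pauliString r) + s' • (Q * pauliString r))
          = (s • (P * P) + s' • (P * Q) + s • (Q * P) + s' • (Q * Q)) * pauliString r := by
        simp only [mul_add, add_mul, Matrix.mul_smul, Matrix.smul_mul, mul_assoc]
        abel
      rw [this, hPP, hQQ, hPQ]
      congr 1
      module
    rw [key]
    rcases hs with rfl | rfl <;> rcases hs' with rfl | rfl
    · exact ⟨0, r, by rw [sub_self, zero_smul, add_zero, Matrix.smul_mul, one_mul]; module⟩
    · obtain ⟨e, u, hu⟩ := pauliString_mul p q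
      obtain ⟨f, t, ht⟩ := pauliString_mul u r
      refine ⟨2 + e + f, t, ?_⟩
      rw [hP, hQ, hu, pow_add, pow_add, mul_smul, mul_smul, ← ht, ← Matrix.smul_mul, Complex.I_sq,
        ← Matrix.smul_mul, ← Matrix.smul_mul]
      congr 1
      module
    · obtain ⟨e, u, hu⟩ := pauliString_mul p q
      obtain ⟨f, t, ht⟩ := pauliString_mul u r
      refine ⟨e + f, t, ?_⟩
      rw [hP, hQ, hu, pow_add, mul_smul, ← ht, ← Matrix.smul_mul, ← Matrix.smul_mul]
      congr 1
      module
    · refine ⟨2, r, ?_⟩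
      rw [sub_self, zero_smul, add_zero, Matrix.smul_mul, one_mul, Complex.I_sq]; module
  have hconjmem : ∀ x ∈ pauliGroup n,
      (⟨H, hmem⟩ : QubitUnitary n) * x * (⟨H, hmem⟩ : QubitUnitary n) ∈ pauliGroup n := by
    rintro x ⟨e, r, hx⟩
    obtain ⟨f, t, ht⟩ := hpauli r
    refine ⟨e + f, t, ?_⟩
    change H * (x : Matrix (Fin n → Fin 2) (Fin n → Fin 2) ℂ) * H = _
    rw [hx, Matrix.mul_smul (M := H), Matrix.smul_mul (Complex.I ^ e), ht, smul_smul, pow_add]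
  have hself : (⟨H, hmem⟩ : QubitUnitary n) * ⟨H, hmem⟩ = 1 := Subtype.ext hHH
  refine ⟨⟨H, hmem⟩, fun x => ?_, ?_⟩
  · rw [inv_eq_of_mul_eq_one_right hself]
    refine ⟨hconjmem x, fun hx => ?_⟩
    have h2 := hconjmem _ hx
    rwa [mul_assoc, mul_assoc, mul_assoc, hself, mul_one, ← mul_assoc, hself, one_mul] at h2
  · change H.conjTranspose * P * H = Q
    rw [hHs, hconj]

/-- The normalized group commutator of the Pauli string `p` with the Heisenberg evolution
`U Z U†` of an operator `Z`. -/
def otoc (Z : Matrix (Fin n → Fin 2) (Fin n → Fin 2) ℂ) (p : Fin n → Fin 4)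
    (U : Matrix (Fin n → Fin 2) (Fin n → Fin 2) ℂ) : ℂ :=
  (pauliString p * (U * Z * U.conjTranspose) * pauliString p
    * (U * Z * U.conjTranspose)).trace / 2 ^ n

theorem continuous_otoc (Z : Matrix (Fin n → Fin 2) (Fin n → Fin 2) ℂ) (p : Fin n → Fin 4) :
    Continuous (otoc Z p) := by
  have hR : Continuous fun U : Matrix (Fin n → Fin 2) (Fin n → Fin 2) ℂ =>
      U * Z * U.conjTranspose :=
    (continuous_id.matrix_mul continuous_const).matrix_mul continuous_id.matrix_conjTranspose
  exact ((((continuous_const.matrix_mul hR).matrix_mul continuous_const).matrix_mul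
    hR).matrix_trace).div_const _

/-- Left multiplication of `U` only changes the probing string; combined with left invariance of
Haar measure this makes mean correlators constant along Clifford orbits of strings. -/
theorem otoc_mul {Z : Matrix (Fin n → Fin 2) (Fin n → Fin 2) ℂ} {p q : Fin n → Fin 4}
    {H : Matrix (Fin n → Fin 2) (Fin n → Fin 2) ℂ}
    (h : H.conjTranspose * pauliString p * H = pauliString q)
    (U : Matrix (Fin n → Fin 2) (Fin n → Fin 2) ℂ) :
    otoc Z p (H * U) = otoc Z q U := by
  have h1 : pauliString p * (H * U * Z * (H * U).conjTranspose) * pauliString p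
      * (H * U * Z * (H * U).conjTranspose)
      = (pauliString p * H * (U * Z * U.conjTranspose) * (H.conjTranspose * pauliString p * H)
        * (U * Z * U.conjTranspose)) * H.conjTranspose := by
    rw [Matrix.conjTranspose_mul]
    simp only [Matrix.mul_assoc]
  have h2 : H.conjTranspose * (pauliString p * H * (U * Z * U.conjTranspose)
        * (H.conjTranspose * pauliString p * H) * (U * Z * U.conjTranspose))
      = (H.conjTranspose * pauliString p * H) * (U * Z * U.conjTranspose)
        * (H.conjTranspose * pauliString p * H) * (U * Z * U.conjTranspose) := by
    simp only [Matrix.mul_assoc]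
  unfold otoc
  rw [h1, Matrix.trace_mul_comm, h2, h]

theorem otoc_of_commute {Z : Matrix (Fin n → Fin 2) (Fin n → Fin 2) ℂ} (hZ : Z * Z = 1)
    {p : Fin n → Fin 4} {U : Matrix (Fin n → Fin 2) (Fin n → Fin 2) ℂ}
    (hU : U ∈ Matrix.unitaryGroup (Fin n → Fin 2) ℂ)
    (h : Commute (pauliString p) (U * Z * U.conjTranspose)) : otoc Z p U = 1 := by
  have hUU : U.conjTranspose * U = 1 := Matrix.mem_unitaryGroup_iff'.1 hU
  have hUU' : U * U.conjTranspose = 1 := Matrix.mem_unitaryGroup_iff.1 hU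
  have hRR : U * Z * U.conjTranspose * (U * Z * U.conjTranspose) = 1 := by
    rw [Matrix.mul_assoc, ← Matrix.mul_assoc U.conjTranspose, ← Matrix.mul_assoc U.conjTranspose,
      hUU, Matrix.one_mul, Matrix.mul_assoc, ← Matrix.mul_assoc Z, hZ, Matrix.one_mul, hUU']
  unfold otoc
  rw [h.eq, Matrix.mul_assoc (U * Z * U.conjTranspose), pauliString_mul_self, Matrix.mul_one, hRR,
    Matrix.trace_one]
  simp

/-- The Pauli twirl turns the sum into a multiple of `(Tr U Z U†)² = (Tr Z)²`. -/
theorem sum_otoc {Z : Matrix (Fin n → Fin 2) (Fin n → Fin 2) ℂ} (hZ : Z.trace = 0)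
    {U : Matrix (Fin n → Fin 2) (Fin n → Fin 2) ℂ}
    (hU : U ∈ Matrix.unitaryGroup (Fin n → Fin 2) ℂ) : ∑ p, otoc Z p U = 0 := by
  have hUU : U.conjTranspose * U = 1 := Matrix.mem_unitaryGroup_iff'.1 hU
  simp only [otoc]
  rw [← Finset.sum_div, sum_trace_pauliString_conj, Matrix.trace_mul_comm, ← Matrix.mul_assoc, hUU,
    Matrix.one_mul, hZ]
  simp

/-- The Haar measure of the Clifford group, as a measure on that group. -/
abbrev cliffordHaar (n : ℕ) : Measure (cliffordGroup n) :=
  Measure.haarMeasure (⊤ : TopologicalSpace.PositiveCompacts (cliffordGroup n))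

instance (n : ℕ) : IsProbabilityMeasure (cliffordHaar n) :=
  ⟨Measure.haarMeasure_self (K₀ := (⊤ : TopologicalSpace.PositiveCompacts (cliffordGroup n)))⟩

theorem integrable_otoc (Z : Matrix (Fin n → Fin 2) (Fin n → Fin 2) ℂ) (p : Fin n → Fin 4) :
    Integrable (fun g : cliffordGroup n => otoc Z p g.1.1) (cliffordHaar n) :=
  ((continuous_otoc Z p).comp (continuous_subtype_val.comp
    continuous_subtype_val)).integrable_of_hasCompactSupport (HasCompactSupport.of_compactSpace _)

theorem integral_otoc_eq_of_stringSign (Z : Matrix (Fin n → Fin 2) (Fin n → Fin 2) ℂ)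
    {p q : Fin n → Fin 4} (hpq : stringSign p q = -1) :
    ∫ g : cliffordGroup n, otoc Z p g.1.1 ∂(cliffordHaar n)
      = ∫ g : cliffordGroup n, otoc Z q g.1.1 ∂(cliffordHaar n) := by
  obtain ⟨h, hh, hconj⟩ := exists_mem_cliffordGroup_conj hpq
  rw [← integral_mul_left_eq_self (fun g : cliffordGroup n => otoc Z p g.1.1) ⟨h, hh⟩]
  refine integral_congr_ae (Filter.Eventually.of_forall fun g => ?_)
  exact otoc_mul hconj _

/-- The Clifford exchange is available only for anticommuting pairs, so the comparison passes
through a string that anticommutes with both. -/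
theorem integral_otoc_eq (Z : Matrix (Fin n → Fin 2) (Fin n → Fin 2) ℂ)
    {p q : Fin n → Fin 4} (hp : p ≠ 0) (hq : q ≠ 0) :
    ∫ g : cliffordGroup n, otoc Z p g.1.1 ∂(cliffordHaar n)
      = ∫ g : cliffordGroup n, otoc Z q g.1.1 ∂(cliffordHaar n) := by
  obtain ⟨r, hr, hr'⟩ := exists_stringSign_eq_neg_one hp hq
  rw [integral_otoc_eq_of_stringSign Z hr, integral_otoc_eq_of_stringSign Z hr']

/-- Under the Haar measure on the Clifford group, a traceless involution evolves to an operator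
slightly biased towards anticommuting with any given nontrivial Pauli string. -/
theorem integral_otoc {Z : Matrix (Fin n → Fin 2) (Fin n → Fin 2) ℂ} (hZ : Z * Z = 1)
    (htr : Z.trace = 0) {p : Fin n → Fin 4} (hp : p ≠ 0) :
    ∫ g : cliffordGroup n, otoc Z p g.1.1 ∂(cliffordHaar n) = ((-1 / (4 ^ n - 1) : ℝ) : ℂ) := by
  have hsum : ∑ q, ∫ g : cliffordGroup n, otoc Z q g.1.1 ∂(cliffordHaar n) = 0 := by
    rw [← integral_finsetSum _ fun q _ => integrable_otoc Z q]
    simp only [sum_otoc htr (Subtype.prop _), integral_zero]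
  have hzero : ∫ g : cliffordGroup n, otoc Z 0 g.1.1 ∂(cliffordHaar n) = 1 := by
    have : ∀ g : cliffordGroup n, otoc Z 0 g.1.1 = 1 := fun g =>
      otoc_of_commute hZ g.1.2 (by rw [pauliString_zero]; exact Commute.one_left _)
    simp only [this, integral_const, probReal_univ, one_smul]
  -- The vanishing sum reads `1 + (4^n - 1) · m = 0`, with `m` the common mean over nontrivial
  -- strings.
  rw [← Finset.add_sum_erase _ _ (Finset.mem_univ 0), hzero,
    Finset.sum_congr rfl fun q hq => integral_otoc_eq Z (Finset.ne_of_mem_erase hq) hp,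
    Finset.sum_const, Finset.card_erase_of_mem (Finset.mem_univ _), Finset.card_univ,
    Fintype.card_fun, Fintype.card_fin, Fintype.card_fin, nsmul_eq_mul,
    Nat.cast_sub (Nat.one_le_pow _ _ (by norm_num))] at hsum
  have hn : n ≠ 0 := by
    rintro rfl
    exact hp (Subsingleton.elim _ _)
  have h4 : (4 ^ n - 1 : ℂ) ≠ 0 := by
    have h1 : (1 : ℝ) < 4 ^ n := one_lt_pow₀ (by norm_num) hn
    have h2 : (4 ^ n - 1 : ℝ) ≠ 0 := by linarith
    exact_mod_cast h2
  push_cast at hsum ⊢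
  rw [eq_div_iff h4]
  linear_combination hsum

end Twirl

/-! ### Supports of operators and light cones of circuits -/

section LightCone

variable {n : ℕ}

theorem ActsOn.mono {S T : Finset (Fin n)} (hST : S ⊆ T)
    {A : Matrix (Fin n → Fin 2) (Fin n → Fin 2) ℂ} (hA : ActsOn S A) : ActsOn T A := by
  obtain ⟨W, hW⟩ := hA
  refine ⟨Matrix.of fun u v => if ∀ i : T, i.1 ∉ S → u i = v i then
    W (fun i => u ⟨i, hST i.2⟩) (fun i => v ⟨i, hST i.2⟩) else 0, fun x y => ?_⟩
  rw [hW, Matrix.of_apply]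
  by_cases h : ∀ i, i ∉ S → x i = y i
  · rw [if_pos h, if_pos fun i hi => h i fun hS => hi (hST hS)]
    exact (if_pos fun (i : T) hi => h i hi).symm
  · rw [if_neg h]
    by_cases h1 : ∀ i, i ∉ T → x i = y i
    · rw [if_pos h1, if_neg]
      intro h2
      refine h fun i hi => ?_
      by_cases hT : i ∈ T
      · exact h2 ⟨i, hT⟩ hi
      · exact h1 i hT
    · rw [if_neg h1]

theorem ActsOn.mul_apply {S T : Finset (Fin n)} (hST : Disjoint S T)
    {A B : Matrix (Fin n → Fin 2) (Fin n → Fin 2) ℂ} {W : Matrix (S → Fin 2) (S → Fin 2) ℂ}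
    {W' : Matrix (T → Fin 2) (T → Fin 2) ℂ}
    (hA : ∀ x y : Fin n → Fin 2,
      A x y = if ∀ i, i ∉ S → x i = y i then W (fun i => x i) (fun i => y i) else 0)
    (hB : ∀ x y : Fin n → Fin 2,
      B x y = if ∀ i, i ∉ T → x i = y i then W' (fun i => x i) (fun i => y i) else 0)
    (x z : Fin n → Fin 2) :
    (A * B) x z = if ∀ i, i ∉ S → i ∉ T → x i = z i then
      W (fun i => x i) (fun i => z i) * W' (fun i => x i) (fun i => z i) else 0 := by
  -- `A` fixes the bits outside `S` and `B` those outside `T ⊇ S`-free positions only, so the one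
  -- intermediate bit string that can contribute follows `z` on `S` and `x` elsewhere.
  rw [Matrix.mul_apply, Finset.sum_eq_single fun i => if i ∈ S then z i else x i]
  · have h1 : ∀ i, i ∉ S → x i = if i ∈ S then z i else x i := fun i hi => by rw [if_neg hi]
    rw [hA, hB, if_pos h1]
    have h2 : (∀ i, i ∉ T → (if i ∈ S then z i else x i) = z i)
        ↔ ∀ i, i ∉ S → i ∉ T → x i = z i := by
      refine forall_congr' fun i => ?_
      by_cases hi : i ∈ S <;> simp [hi]
    simp only [h2, mul_ite, mul_zero]
    congr 2
    · congr 1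
      ext i
      simp
    · congr 1
      ext i
      rw [if_neg fun h => Finset.disjoint_left.1 hST h i.2]
  · intro y _ hy
    rw [hA, hB]
    by_cases h1 : ∀ i, i ∉ S → x i = y i
    · by_cases h2 : ∀ i, i ∉ T → y i = z i
      · refine absurd (funext fun i => ?_) hy
        by_cases hi : i ∈ S
        · rw [if_pos hi, h2 i (Finset.disjoint_left.1 hST hi)]
        · rw [if_neg hi, h1 i hi]
      · rw [if_neg h2, mul_zero]
    · rw [if_neg h1, zero_mul]
  · simp

theorem ActsOn.commute {S T : Finset (Fin n)} (hST : Disjoint S T)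
    {A B : Matrix (Fin n → Fin 2) (Fin n → Fin 2) ℂ} (hA : ActsOn S A) (hB : ActsOn T B) :
    Commute A B := by
  obtain ⟨W, hW⟩ := hA
  obtain ⟨W', hW'⟩ := hB
  ext x z
  rw [ActsOn.mul_apply hST hW hW', ActsOn.mul_apply hST.symm hW' hW, mul_comm]
  congr 1
  exact propext (forall_congr' fun i => ⟨fun h a b => h b a, fun h a b => h b a⟩)

theorem actsOn_pauliString_single (i : Fin n) (a : Fin 4) :
    ActsOn {i} (pauliString (Pi.single i a)) := by
  refine ⟨fun u v => pauli a (u ⟨i, by simp⟩) (v ⟨i, by simp⟩), fun x y => ?_⟩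
  rw [pauliString, Matrix.of_apply, ← Finset.mul_prod_erase _ _ (Finset.mem_univ i),
    Pi.single_eq_same]
  have : ∀ j ∈ Finset.univ.erase i, pauli ((Pi.single i a : Fin n → Fin 4) j) (x j) (y j)
      = if x j = y j then 1 else 0 := by
    intro j hj
    rw [Pi.single_eq_of_ne (Finset.ne_of_mem_erase hj)]
    simp [pauli, Matrix.one_apply]
  rw [Finset.prod_congr rfl this, Finset.prod_ite_zero]
  simp

/-- `A` is supported on `S`: it commutes with all operators acting on the complement of `S`. -/
def SupportedOn (S : Finset (Fin n)) (A : Matrix (Fin n → Fin 2) (Fin n → Fin 2) ℂ) : Prop :=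
  ∀ B, ActsOn Sᶜ B → Commute A B

theorem ActsOn.supportedOn {S : Finset (Fin n)} {A : Matrix (Fin n → Fin 2) (Fin n → Fin 2) ℂ}
    (hA : ActsOn S A) : SupportedOn S A :=
  fun _ hB => hA.commute disjoint_compl_right hB

theorem SupportedOn.mono {S T : Finset (Fin n)} (hST : S ⊆ T)
    {A : Matrix (Fin n → Fin 2) (Fin n → Fin 2) ℂ} (hA : SupportedOn S A) : SupportedOn T A :=
  fun B hB => hA B (hB.mono (Finset.compl_subset_compl.2 hST))

theorem SupportedOn.commute_of_disjoint {S T : Finset (Fin n)} (hST : Disjoint S T)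
    {A B : Matrix (Fin n → Fin 2) (Fin n → Fin 2) ℂ} (hA : SupportedOn S A) (hB : ActsOn T B) :
    Commute A B :=
  hA B (hB.mono (Finset.subset_compl_iff_disjoint_left.2 hST))

theorem SupportedOn.conj {S : Finset (Fin n)} {A : Matrix (Fin n → Fin 2) (Fin n → Fin 2) ℂ}
    (hA : SupportedOn S A) {g : QubitUnitary n} (hg : SupportedOn S g.1) :
    SupportedOn S (g.1 * A * (g⁻¹).1) := by
  intro B hB
  have h1 : g.1 * (g⁻¹).1 = 1 := congrArg Subtype.val (mul_inv_cancel g)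
  have h2 : (g⁻¹).1 * g.1 = 1 := congrArg Subtype.val (inv_mul_cancel g)
  have hinv : Commute (g⁻¹).1 B := by
    have := (hg B hB).eq
    calc (g⁻¹).1 * B = (g⁻¹).1 * (B * g.1) * (g⁻¹).1 := by
          rw [mul_assoc, mul_assoc, h1, mul_one]
      _ = B * (g⁻¹).1 := by rw [← this, ← mul_assoc, h2, one_mul]
  exact ((hg B hB).mul_left (hA B hB)).mul_left hinv

/-- Conjugation by a product of local gates on disjoint locations enlarges the support at most to
those locations that meet it. -/
theorem SupportedOn.conj_gates {S T : Finset (Fin n)} (hST : S ⊆ T)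
    {A : Matrix (Fin n → Fin 2) (Fin n → Fin 2) ℂ} (hA : SupportedOn S A)
    (gates : List (Finset (Fin n) × QubitUnitary n)) (hacts : ∀ g ∈ gates, ActsOn g.1 g.2.1)
    (hdisj : gates.Pairwise fun g h => Disjoint g.1 h.1)
    (hT : ∀ g ∈ gates, ¬ Disjoint S g.1 → g.1 ⊆ T) :
    SupportedOn T ((gates.map Prod.snd).prod.1 * A * ((gates.map Prod.snd).prod⁻¹).1) := by
  induction gates generalizing T with
  | nil => simpa using hA.mono hST
  | cons g gates ih =>
    rw [List.pairwise_cons] at hdisj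
    have hconj : ((g :: gates).map Prod.snd).prod.1 * A * (((g :: gates).map Prod.snd).prod⁻¹).1
        = g.2.1 * ((gates.map Prod.snd).prod.1 * A * ((gates.map Prod.snd).prod⁻¹).1)
          * (g.2⁻¹).1 := by
      rw [List.map_cons, List.prod_cons, mul_inv_rev, Submonoid.coe_mul, Submonoid.coe_mul]
      simp only [mul_assoc]
    rw [hconj]
    by_cases hg : Disjoint S g.1
    · have hsup := ih (T := T \ g.1) (Finset.subset_sdiff.2 ⟨hST, hg⟩)
        (fun k hk => hacts k (List.mem_cons_of_mem _ hk)) hdisj.2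
        (fun k hk hSk => Finset.subset_sdiff.2
          ⟨hT k (List.mem_cons_of_mem _ hk) hSk, (hdisj.1 k hk).symm⟩)
      have hcomm := hsup.commute_of_disjoint Finset.sdiff_disjoint (hacts g List.mem_cons_self)
      rw [← hcomm.eq, mul_assoc]
      have h1 : g.2.1 * (g.2⁻¹).1 = 1 := congrArg Subtype.val (mul_inv_cancel g.2)
      rw [h1, mul_one]
      exact hsup.mono Finset.sdiff_subset
    · refine (ih hST (fun k hk => hacts k (List.mem_cons_of_mem _ hk)) hdisj.2
        fun k hk => hT k (List.mem_cons_of_mem _ hk)).conj ?_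
      exact (hacts g List.mem_cons_self).supportedOn.mono (hT g List.mem_cons_self hg)

/-- The first `m + 1` qubits. -/
def firstQubits (n m : ℕ) : Finset (Fin n) := Finset.univ.filter fun i => i.val ≤ m

theorem IsLayer.supportedOn_conj {V : QubitUnitary n} (hV : IsLayer V) {m : ℕ}
    {A : Matrix (Fin n → Fin 2) (Fin n → Fin 2) ℂ} (hA : SupportedOn (firstQubits n m) A) :
    SupportedOn (firstQubits n (m + 1)) (V.1 * A * (V⁻¹).1) := by
  obtain ⟨gates, hlocal, hdisj, rfl⟩ := hV
  refine hA.conj_gates ?_ gates (fun g hg => (hlocal g hg).2.2) hdisj fun g hg hmeet => ?_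
  · intro i hi
    simp only [firstQubits, Finset.mem_filter, Finset.mem_univ, true_and] at hi ⊢
    lia
  · obtain ⟨i, j, hij, hS⟩ := (hlocal g hg).2.1
    rw [hS] at hmeet ⊢
    -- A gate that meets the first `m + 1` qubits has its left end among them, so its right end is
    -- at most `m + 1`: each layer moves the front by one.
    have hi : i.val ≤ m := by
      by_contra hi
      refine hmeet (Finset.disjoint_left.2 fun k hk hk' => ?_)
      simp only [firstQubits, Finset.mem_filter, Finset.mem_univ, true_and] at hk
      simp only [Finset.mem_insert, Finset.mem_singleton] at hk'
      rcases hij with rfl | hij <;> rcases hk' with rfl | rfl <;> lia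
    intro k hk
    simp only [Finset.mem_insert, Finset.mem_singleton] at hk
    simp only [firstQubits, Finset.mem_filter, Finset.mem_univ, true_and]
    rcases hij with rfl | hij <;> rcases hk with rfl | rfl <;> lia

/-- The light cone of the first `m + 1` qubits under a circuit. -/
theorem supportedOn_conj_prod_layers (layers : List (QubitUnitary n))
    (h : ∀ V ∈ layers, IsLayer V) {m : ℕ} {A : Matrix (Fin n → Fin 2) (Fin n → Fin 2) ℂ}
    (hA : SupportedOn (firstQubits n m) A) :
    SupportedOn (firstQubits n (m + layers.length))
      (layers.prod.1 * A * (layers.prod⁻¹).1) := by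
  induction layers with
  | nil => simpa using hA
  | cons V layers ih =>
    have := (h V List.mem_cons_self).supportedOn_conj
      (ih fun W hW => h W (List.mem_cons_of_mem _ hW))
    rw [List.length_cons, ← add_assoc]
    convert this using 1
    rw [List.prod_cons, mul_inv_rev, Submonoid.coe_mul, Submonoid.coe_mul]
    simp only [mul_assoc]

theorem IsCliffordCircuit.commute_pauliString {L : ℕ} {U : QubitUnitary n}
    (hU : IsCliffordCircuit L U) {i j : Fin n} (hij : i.val + L < j.val) (a b : Fin 4) :
    Commute (pauliString (Pi.single j b))
      (U.1 * pauliString (Pi.single i a) * U.1.conjTranspose) := by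
  obtain ⟨layers, rfl, hlayers, rfl⟩ := hU
  have hi : SupportedOn (firstQubits n i.val) (pauliString (Pi.single i a)) :=
    (actsOn_pauliString_single i a).supportedOn.mono (by simp [firstQubits])
  refine ((supportedOn_conj_prod_layers layers hlayers hi).commute_of_disjoint ?_
    (actsOn_pauliString_single j b)).symm
  simp only [firstQubits, Finset.disjoint_singleton_right, Finset.mem_filter, Finset.mem_univ,
    true_and]
  lia

theorem IsCliffordCircuit.mem_cliffordGroup {L : ℕ} {U : QubitUnitary n}
    (hU : IsCliffordCircuit L U) : U ∈ cliffordGroup n := by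
  obtain ⟨layers, -, hlayers, rfl⟩ := hU
  refine Subgroup.list_prod_mem _ fun V hV => ?_
  obtain ⟨gates, hlocal, -, rfl⟩ := hlayers V hV
  refine Subgroup.list_prod_mem _ fun g hg => ?_
  obtain ⟨k, hk, rfl⟩ := List.mem_map.1 hg
  exact (hlocal k hk).1

end LightCone

/-! ### The probe state, the reflection and its two expectation values -/

section Distinguisher

variable {n : ℕ}

/-- Together with 1, the operators `D 1`, `D 2`, `D 3` multiply as a Klein four-group, so `M = (1 +
D 1 + D 2 + D 3) / 4` is an orthogonal projection and the operator here is `2 M - 1`. -/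
theorem mem_unitaryGroup_of_commuting_involutions {Y : Type*} [Fintype Y] [DecidableEq Y]
    {D : Fin 4 → Matrix Y Y ℂ} (hD : ∀ a, (D a).conjTranspose = D a) (h0 : ∀ a, D a * D a = 1)
    (h12 : D 1 * D 2 = D 3) (h21 : D 2 * D 1 = D 3) (h13 : D 1 * D 3 = D 2) (h31 : D 3 * D 1 = D 2)
    (h23 : D 2 * D 3 = D 1) (h32 : D 3 * D 2 = D 1) :
    (1 / 2 : ℂ) • (D 1 + D 2 + D 3 - 1) ∈ Matrix.unitaryGroup Y ℂ := by
  rw [Matrix.mem_unitaryGroup_iff, Matrix.star_eq_conjTranspose, Matrix.conjTranspose_smul,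
    Matrix.conjTranspose_sub, Matrix.conjTranspose_add, Matrix.conjTranspose_add, hD, hD, hD,
    Matrix.conjTranspose_one, Matrix.smul_mul, Matrix.mul_smul, smul_smul]
  simp only [add_mul, mul_add, sub_mul, mul_sub, h0, h12, h21, h13, h31, h23, h32, mul_one,
    one_mul]
  have : (1 / 2 : ℂ) * star (1 / 2) = 1 / 4 := by norm_num
  rw [this]
  module

/-- The eightfold tensor power of the Pauli matrix `a` on qubit `j`. -/
def pauliPower (j : Fin n) (a : Fin 4) :
    Matrix (Fin 8 → Fin n → Fin 2) (Fin 8 → Fin n → Fin 2) ℂ :=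
  tensorPow 8 (pauliString (Pi.single j a))

/-- The reflection `2 M - 1`, with `M` the projection onto the joint `+1` eigenspace of
`X^{⊗8}`, `Y^{⊗8}` and `Z^{⊗8}` on qubit `j`. -/
def commutationReflection (j : Fin n) :
    Matrix (Fin 8 → Fin n → Fin 2) (Fin 8 → Fin n → Fin 2) ℂ :=
  (1 / 2 : ℂ) • (pauliPower j 1 + pauliPower j 2 + pauliPower j 3 - 1)

/-- The phases `±i` in products of Pauli matrices disappear in the eighth power, so the `pauliPower`
operators commute and multiply without phases. -/
theorem pauliPower_mul {j : Fin n} {a b c : Fin 4} {s : ℂ}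
    (h : pauli a * pauli b = s • pauli c) (hs : s ^ 8 = 1) :
    pauliPower j a * pauliPower j b = pauliPower j c := by
  rw [pauliPower, pauliPower, ← tensorPow_mul, pauliString_single_mul h, tensorPow_smul, hs,
    one_smul, pauliPower]

theorem commutationReflection_mem_unitaryGroup (j : Fin n) :
    commutationReflection j ∈ Matrix.unitaryGroup (Fin 8 → Fin n → Fin 2) ℂ := by
  have hI : Complex.I ^ 8 = 1 := by
    rw [show 8 = 4 * 2 from rfl, pow_mul, Complex.I_pow_four, one_pow]
  have hI' : (-Complex.I) ^ 8 = 1 := by rw [neg_pow, hI]; norm_num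
  refine mem_unitaryGroup_of_commuting_involutions (fun a => ?_) (fun a => ?_)
    (pauliPower_mul (s := Complex.I) ?_ hI) (pauliPower_mul (s := -Complex.I) ?_ hI')
    (pauliPower_mul (s := -Complex.I) ?_ hI') (pauliPower_mul (s := Complex.I) ?_ hI)
    (pauliPower_mul (s := Complex.I) ?_ hI) (pauliPower_mul (s := -Complex.I) ?_ hI')
  · rw [pauliPower, ← tensorPow_conjTranspose, pauliString_conjTranspose]
  · rw [pauliPower, ← tensorPow_mul, pauliString_mul_self, tensorPow_one]
  all_goals simp [pauli]

/-- Four maximally entangled pairs, with the operator `Z` applied to one half of the first. -/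
def probePairs (Z : Matrix (Fin n → Fin 2) (Fin n → Fin 2) ℂ) (k : Fin 4) :
    Matrix (Fin n → Fin 2) (Fin n → Fin 2) ℂ :=
  (((√(2 ^ n))⁻¹ : ℝ) : ℂ) • if k = 0 then Z else 1

/-- The pure state with amplitudes `probePairs`. -/
def probeState (Z : Matrix (Fin n → Fin 2) (Fin n → Fin 2) ℂ) :
    Matrix (Fin 8 → Fin n → Fin 2) (Fin 8 → Fin n → Fin 2) ℂ :=
  Matrix.vecMulVec (pairVector (probePairs Z)) (star (pairVector (probePairs Z)))

theorem trace_probePairs {Z B C : Matrix (Fin n → Fin 2) (Fin n → Fin 2) ℂ} (k : Fin 4) :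
    ((probePairs Z k).conjTranspose * B * probePairs Z k * C).trace
      = ((if k = 0 then Z else 1).conjTranspose * B * (if k = 0 then Z else 1) * C).trace
        / 2 ^ n := by
  have hc : (((√(2 ^ n))⁻¹ : ℝ) : ℂ) * (((√(2 ^ n))⁻¹ : ℝ) : ℂ) = (2 ^ n)⁻¹ := by
    rw [← Complex.ofReal_mul, ← mul_inv, Real.mul_self_sqrt (by positivity)]
    push_cast
    rfl
  rw [probePairs, Matrix.conjTranspose_smul, Complex.star_def, Complex.conj_ofReal,
    Matrix.smul_mul, Matrix.smul_mul, Matrix.mul_smul, Matrix.smul_mul, Matrix.smul_mul, smul_smul,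
    hc, Matrix.trace_smul, smul_eq_mul, div_eq_inv_mul]

theorem isState_probeState {Z : Matrix (Fin n → Fin 2) (Fin n → Fin 2) ℂ}
    (hZ : Z.conjTranspose * Z = 1) : IsState (probeState Z) := by
  refine isState_pairVector _ fun k => ?_
  have := trace_probePairs (Z := Z) (B := 1) (C := 1) k
  rw [Matrix.mul_one, Matrix.mul_one, Matrix.mul_one, Matrix.mul_one] at this
  rw [this]
  split_ifs <;> simp [hZ]

/-- On the probe state, the Pauli observable `P^{⊗8}` measures the commutation of `P` with the
evolution of `Z` under a Clifford unitary. -/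
theorem trace_tensorPow_mul_conjPow_probeState
    {Z : Matrix (Fin n → Fin 2) (Fin n → Fin 2) ℂ} (hZ : Z.conjTranspose = Z)
    (p : Fin n → Fin 4) {U : QubitUnitary n} (hU : U ∈ cliffordGroup n) :
    (tensorPow 8 (pauliString p) * conjPow 8 U.1 (probeState Z)).trace = otoc Z p U.1 := by
  have hUU' : U.1 * U.1.conjTranspose = 1 := Matrix.mem_unitaryGroup_iff.1 U.2
  have hUU : U.1.conjTranspose * U.1 = 1 := Matrix.mem_unitaryGroup_iff'.1 U.2
  have hPmem : pauliString p ∈ Matrix.unitaryGroup (Fin n → Fin 2) ℂ := by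
    rw [Matrix.mem_unitaryGroup_iff, Matrix.star_eq_conjTranspose, pauliString_conjTranspose,
      pauliString_mul_self]
  have hP : (⟨pauliString p, hPmem⟩ : QubitUnitary n) ∈ pauliGroup n := ⟨0, p, by simp⟩
  -- This is where `U` must be Clifford: `U† P U` is a phase times a Pauli string, hence symmetric
  -- or antisymmetric.
  obtain ⟨e, q, hB⟩ : U⁻¹ * ⟨pauliString p, hPmem⟩ * U⁻¹⁻¹ ∈ pauliGroup n :=
    ((inv_mem hU) _).1 hP
  rw [inv_inv] at hB
  change U.1.conjTranspose * pauliString p * U.1 = _ at hB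
  rw [trace_tensorPow_mul_conjPow, probeState, trace_tensorPow_mul_pairVector]
  set B := U.1.conjTranspose * pauliString p * U.1 with hBdef
  have hBB : B * B = 1 := by
    have : B * B = U.1.conjTranspose * (pauliString p * (U.1 * U.1.conjTranspose)
        * pauliString p) * U.1 := by
      rw [hBdef]
      simp only [Matrix.mul_assoc]
    rw [this, hUU', Matrix.mul_one, pauliString_mul_self, Matrix.mul_one, hUU]
  obtain ⟨s, hs, hsq⟩ := pauliString_transpose q
  have hBt : B.transpose = s • B := by
    rw [hB, Matrix.transpose_smul, hsq, smul_comm]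
  have hZB : (Z * B * Z * B).trace = 2 ^ n * otoc Z p U.1 := by
    have h1 : Z * B * Z * B = Z * U.1.conjTranspose * (pauliString p * (U.1 * Z * U.1.conjTranspose)
        * pauliString p * U.1) := by
      rw [hBdef]
      simp only [Matrix.mul_assoc]
    have h2 : pauliString p * (U.1 * Z * U.1.conjTranspose) * pauliString p * U.1
          * (Z * U.1.conjTranspose)
        = pauliString p * (U.1 * Z * U.1.conjTranspose) * pauliString p
          * (U.1 * Z * U.1.conjTranspose) := by
      simp only [Matrix.mul_assoc]
    rw [h1, Matrix.trace_mul_comm, h2, otoc, mul_div_cancel₀ _ (by positivity)]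
  simp only [trace_probePairs, hBt, Fin.prod_univ_four, Matrix.mul_smul, Matrix.trace_smul]
  simp only [if_true, Fin.reduceEq, if_false, one_ne_zero, Matrix.conjTranspose_one,
    Matrix.one_mul, Matrix.mul_one, hBB, hZ, hZB, Matrix.trace_one, smul_eq_mul, Fintype.card_fun,
    Fintype.card_fin, Nat.cast_pow, Nat.cast_ofNat]
  have h2 : (2 ^ n : ℂ) ≠ 0 := by positivity
  field_simp
  -- The first pair gives `s · otoc` and each of the other three gives `s`; the total sign is `s ^ 4
  -- = 1`.
  linear_combination (s ^ 2 + 1) * otoc Z p U.1 * hs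

theorem trace_commutationReflection_mul_conjPow
    {Z : Matrix (Fin n → Fin 2) (Fin n → Fin 2) ℂ} (hZ : Z.conjTranspose = Z) (hZZ : Z * Z = 1)
    (j : Fin n) {U : QubitUnitary n} (hU : U ∈ cliffordGroup n) :
    (commutationReflection j * conjPow 8 U.1 (probeState Z)).trace
      = (1 / 2 : ℂ) * (otoc Z (Pi.single j 1) U.1 + otoc Z (Pi.single j 2) U.1
        + otoc Z (Pi.single j 3) U.1 - 1) := by
  have h1 : (conjPow 8 U.1 (probeState Z)).trace = 1 := by
    have := trace_tensorPow_mul_conjPow_probeState hZ 0 hU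
    rwa [pauliString_zero, tensorPow_one, Matrix.one_mul, otoc_of_commute hZZ U.2
      (by rw [pauliString_zero]; exact Commute.one_left _)] at this
  rw [commutationReflection, Matrix.smul_mul, Matrix.trace_smul, sub_mul, add_mul, add_mul,
    Matrix.trace_sub, Matrix.trace_add, Matrix.trace_add, Matrix.one_mul, h1, pauliPower,
    pauliPower, pauliPower, trace_tensorPow_mul_conjPow_probeState hZ _ hU,
    trace_tensorPow_mul_conjPow_probeState hZ _ hU,
    trace_tensorPow_mul_conjPow_probeState hZ _ hU, smul_eq_mul]

theorem trace_commutationReflection_mul_momentChannel_of_circuit {L : ℕ} {i j : Fin n}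
    (hij : i.val + L < j.val) {a : Fin 4}
    (ℰ : Measure (QubitUnitary n)) [IsProbabilityMeasure ℰ]
    (hcircuit : ∀ᵐ U ∂ℰ, IsCliffordCircuit L U) :
    (commutationReflection j * momentChannel 8 ℰ (probeState (pauliString (Pi.single i a)))).trace
      = 1 := by
  rw [trace_mul_momentChannel]
  have : ∀ᵐ U ∂ℰ, (commutationReflection j *
      conjPow 8 U.1 (probeState (pauliString (Pi.single i a)))).trace = 1 := by
    filter_upwards [hcircuit] with U hU
    rw [trace_commutationReflection_mul_conjPow (pauliString_conjTranspose _)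
      (pauliString_mul_self _) j hU.mem_cliffordGroup,
      otoc_of_commute (pauliString_mul_self _) U.2 (hU.commute_pauliString hij a 1),
      otoc_of_commute (pauliString_mul_self _) U.2 (hU.commute_pauliString hij a 2),
      otoc_of_commute (pauliString_mul_self _) U.2 (hU.commute_pauliString hij a 3)]
    norm_num
  rw [integral_congr_ae this]
  simp

theorem trace_commutationReflection_mul_momentChannel_haarEnsemble (j : Fin n)
    {p : Fin n → Fin 4} (hp : p ≠ 0) :
    (commutationReflection j *
      momentChannel 8 (haarEnsemble (cliffordGroup n)) (probeState (pauliString p))).trace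
      = ((-1 / 2 - 3 / 2 / (4 ^ n - 1) : ℝ) : ℂ) := by
  have hmeas : MeasurableSet (cliffordGroup n : Set (QubitUnitary n)) :=
    (isCompact_iff_compactSpace.mpr
      (inferInstanceAs (CompactSpace (cliffordGroup n)))).isClosed.measurableSet
  have hne : ∀ b : Fin 4, b ≠ 0 → (Pi.single j b : Fin n → Fin 4) ≠ 0 := fun b hb h =>
    hb (by simpa using congrFun h j)
  rw [trace_mul_momentChannel, haarEnsemble]
  refine ((MeasurableEmbedding.subtype_coe hmeas).integral_map (μ := cliffordHaar n) _).trans ?_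
  have : ∀ g : cliffordGroup n, (commutationReflection j *
      conjPow 8 g.1.1 (probeState (pauliString p))).trace
      = (1 / 2 : ℂ) * (otoc (pauliString p) (Pi.single j 1) g.1.1
        + otoc (pauliString p) (Pi.single j 2) g.1.1
        + otoc (pauliString p) (Pi.single j 3) g.1.1 - 1) := fun g =>
    trace_commutationReflection_mul_conjPow (pauliString_conjTranspose _)
      (pauliString_mul_self _) j g.2
  have hint := fun b : Fin 4 => integrable_otoc (pauliString p) (Pi.single j b)
  have hval := fun (b : Fin 4) (hb : b ≠ 0) =>
    integral_otoc (pauliString_mul_self p) (trace_pauliString hp) (hne b hb)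
  refine (integral_congr_ae (Filter.Eventually.of_forall this)).trans ?_
  rw [integral_const_mul, integral_sub (((hint 1).fun_add (hint 2)).fun_add (hint 3)) (integrable_const _),
    integral_add ((hint 1).fun_add (hint 2)) (hint 3), integral_add (hint 1) (hint 2),
    hval 1 (by decide), hval 2 (by decide), hval 3 (by decide), integral_const, probReal_univ,
    one_smul]
  push_cast
  ring

end Distinguisher

end CliffordDesign

end

/-! ### The depth bound -/

theorem corollary4 (n L : ℕ) (ε : ℝ≥0) (hε : ε ≤ 3 / 2)
    (ℰ : Measure (CliffordDesign.QubitUnitary n)) [IsProbabilityMeasure ℰ]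
    (hcircuit : ∀ᵐ U ∂ℰ, CliffordDesign.IsCliffordCircuit L U)
    (hdesign : CliffordDesign.IsApproxDesign (CliffordDesign.cliffordGroup n) 8 ε ℰ) :
    (L : ℤ) ≥ (n : ℤ) - 1 := by
  by_contra hL
  -- The two ends of the line are at distance `n - 1 > L`, just beyond the reach of the light cone.
  let i : Fin n := ⟨0, by lia⟩
  let j : Fin n := ⟨n - 1, by lia⟩
  have hij : i.val + L < j.val := by change 0 + L < n - 1; lia
  have hp : (Pi.single i 3 : Fin n → Fin 4) ≠ 0 := fun h => by simpa using congrFun h i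
  have hbound := CliffordDesign.ofReal_norm_trace_mul_le_diamondNorm
    (CliffordDesign.momentChannel 8 ℰ -
      CliffordDesign.momentChannel 8 (CliffordDesign.haarEnsemble (CliffordDesign.cliffordGroup n)))
    (CliffordDesign.commutationReflection_mem_unitaryGroup j)
    (CliffordDesign.isState_probeState (Z := CliffordDesign.pauliString (Pi.single i 3))
      (by rw [CliffordDesign.pauliString_conjTranspose, CliffordDesign.pauliString_mul_self]))
  have hlt : (1 : ℝ) < 4 ^ n := one_lt_pow₀ (by norm_num) (by lia)
  -- This excess of the gap over 3/2 makes the contradiction strict, so that `ε = 3/2` is covered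
  -- too.
  have hpos : (0 : ℝ) < 3 / 2 / (4 ^ n - 1) := div_pos (by norm_num) (by linarith)
  rw [LinearMap.sub_apply, Matrix.mul_sub, Matrix.trace_sub,
    CliffordDesign.trace_commutationReflection_mul_momentChannel_of_circuit hij ℰ hcircuit,
    CliffordDesign.trace_commutationReflection_mul_momentChannel_haarEnsemble j hp,
    ← Complex.ofReal_one, ← Complex.ofReal_sub, Complex.norm_real, Real.norm_eq_abs,
    abs_of_pos (by linarith)] at hbound
  have hle := hbound.trans hdesign
  rw [ENNReal.ofReal_le_iff_le_toReal ENNReal.coe_ne_top, ENNReal.coe_toReal] at hle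
  have hε' : (ε : ℝ) ≤ 3 / 2 := by exact_mod_cast hε
  linarith
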